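/- **Proposition 2.1 (first moments).** Let $\lambda_0>0$, $a\ge 0$, $b>0$, $c>0$, $d\ge 0$ with $ac<b(c+d)$. Let $X_t=(\Lambda_t,\Gamma_t,N_t)$, $t\ge 0$, be a buffer-Hawkes process with these parameters, that is, an adapted process with càdlàg paths in $\mathbb R_+\times\mathbb N\times\mathbb N$ on a filtered probability space, with $X_0=(\lambda_0,0,0)$ almost surely and with generator $$\begin{aligned}\mathcal L f(\lambda,\gamma,n)=\;&b(\lambda_0-\lambda)\,\partial_\lambda f(\lambda,\gamma,n)+\lambda\big(f(\lambda,\gamma+1,n)-f(\lambda,\gamma,n)\big)\\&+d\gamma\big(f(\lambda,\gamma-1,n)-f(\lambda,\gamma,n)\big)+c\gamma\big(f(\lambda+a,\gamma-1,n+1)-f(\lambda,\gamma,n)\big),\end{aligned}$$ in the sense that $f(X_t)-f(X_0)-\int_0^t\mathcal Lf(X_s)\,ds$ is a martingale for every compactly supported $f$ that is continuously differentiable in $\lambda$. Put $$Q=\sqrt{(b-c-d)^2+4ac},\qquad q_\pm=\tfrac12(b+c+d\pm Q).$$ Then for every $t\ge 0$ the variables $\Lambda_t,\Gamma_t,N_t$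 are integrable, and their means $\ell_t=\mathbb E\Lambda_t$, $g_t=\mathbb E\Gamma_t$, $m_t=\mathbb E N_t$ are as follows. If $Q>0$, then $$\ell_t=\frac{\lambda_0}{q_+-q_-}\Big(q_+-q_-+ac\int_0^t\big(e^{-q_-s}-e^{-q_+s}\big)\,ds\Big),$$ $$g_t=\frac{\lambda_0}{q_+-q_-}\Big(e^{-q_-t}-e^{-q_+t}+b\int_0^t\big(e^{-q_-s}-e^{-q_+s}\big)\,ds\Big).$$ If $Q=0$ (that is, $a=0$ and $b=c+d$), then these quotients are replaced by their limiting values $$\ell_t=\lambda_0,\qquad g_t=\frac{\lambda_0}{c+d}\big(1-e^{-(c+d)t}\big).$$ In all cases $$m_t=c\int_0^t g_s\,ds.$$ -/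

import Mathlib

open MeasureTheory Filter Topology
open scoped NNReal

namespace BufferHawkes

/-- `Q = √((b - c - d)² + 4ac)`. -/
noncomputable def Q (a b c d : ℝ) : ℝ := Real.sqrt ((b - c - d) ^ 2 + 4 * a * c)

/-- `q₋ = (b + c + d - Q) / 2`. -/
noncomputable def qMinus (a b c d : ℝ) : ℝ := (b + c + d - Q a b c d) / 2

/-- `q₊ = (b + c + d + Q) / 2`. -/
noncomputable def qPlus (a b c d : ℝ) : ℝ := (b + c + d + Q a b c d) / 2

/-- The generator of the buffer-Hawkes process on functions `f (λ, γ, n)`: the intensity `λ`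
reverts to `lam0` at speed `b`, a limit order enters at rate `λ`, is cancelled at rate `d γ`, and
is executed at rate `c γ`, where an execution raises `λ` by `a` and the market order count `n`
by one. At `γ = 0` the last two rates vanish, so the value of the truncated difference `γ - 1`
in `ℕ` is irrelevant there. -/
noncomputable def generator (lam0 a b c d : ℝ) (f : ℝ × ℕ × ℕ → ℝ) (x : ℝ × ℕ × ℕ) : ℝ :=
  b * (lam0 - x.1) * deriv (fun l : ℝ => f (l, x.2.1, x.2.2)) x.1
    + x.1 * (f (x.1, x.2.1 + 1, x.2.2) - f x)
    + d * (x.2.1 : ℝ) * (f (x.1, x.2.1 - 1, x.2.2) - f x)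
    + c * (x.2.1 : ℝ) * (f (x.1 + a, x.2.1 - 1, x.2.2 + 1) - f x)

/-- Test functions: compactly supported functions of `(λ, γ, n)` that are continuously
differentiable in `λ`. -/
structure IsTestFunction (f : ℝ × ℕ × ℕ → ℝ) : Prop where
  compactSupport : HasCompactSupport f
  contDiff : ∀ γ n : ℕ, ContDiff ℝ 1 (fun l : ℝ => f (l, γ, n))

/-- `X = (Λ, Γ, N)` is a buffer-Hawkes process with parameters `lam0, a, b, c, d` on the filtered
probability space `(Ω, ℱ, μ)`: an adapted process with càdlàg paths in `ℝ₊ × ℕ × ℕ`, started at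
`(lam0, 0, 0)`, which solves the martingale problem for `generator lam0 a b c d`, that is,
`f (X_t) - f (X_0) - ∫₀ᵗ (generator f) (X_s) ds` is a martingale for each test function `f`.
Test functions have compact support: no moment of the process is assumed to be finite, and
the coordinate functions are not test functions. -/
structure IsBufferHawkes {Ω : Type*} {mΩ : MeasurableSpace Ω} (μ : Measure Ω)
    (ℱ : Filtration ℝ≥0 mΩ) (lam0 a b c d : ℝ)
    (Λ : ℝ≥0 → Ω → ℝ) (Γ N : ℝ≥0 → Ω → ℕ) : Prop where
  nonneg : ∀ t ω, 0 ≤ Λ t ω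
  adapted : Adapted ℱ (fun t ω => (Λ t ω, Γ t ω, N t ω))
  rightCts : ∀ ω t, ContinuousWithinAt (fun s => (Λ s ω, Γ s ω, N s ω)) (Set.Ici t) t
  leftLim : ∀ ω t, ∃ x : ℝ × ℕ × ℕ,
    Tendsto (fun s => (Λ s ω, Γ s ω, N s ω)) (𝓝[<] t) (𝓝 x)
  initial : ∀ᵐ ω ∂μ, Λ 0 ω = lam0 ∧ Γ 0 ω = 0 ∧ N 0 ω = 0
  martingale : ∀ f : ℝ × ℕ × ℕ → ℝ, IsTestFunction f →
    Martingale (fun t ω => f (Λ t ω, Γ t ω, N t ω) - f (Λ 0 ω, Γ 0 ω, N 0 ω)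
      - ∫ s in (0 : ℝ)..(t : ℝ), generator lam0 a b c d f
          (Λ s.toNNReal ω, Γ s.toNNReal ω, N s.toNNReal ω)) ℱ μ

end BufferHawkes

/-!
Write `V = α λ + β γ + δ n` for a linear functional of the state. Applying the generator to
the coordinates gives the linear system `ℓ' = b (lam0 - ℓ) + a c g`, `g' = ℓ - (c + d) g`, `m' = c g`
for the means, whose solution is the stated closed form. The point is that the martingale problem is
given for compactly supported functions only and that no moment is assumed finite. No stopping
times are used; three limits lead from test functions to the coordinates.

* For positive weights, `exp (-V)` is a limit of test functions whose generators are uniformly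
  bounded, since `exp (-V)` beats the linearly growing jump rates. Hence Dynkin's formula holds for
  `exp (-V)` (`IsBufferHawkes.dynkin_exp`) and for the saturated weights `(1 - exp (-ε V)) / ε`.
* By the stability condition there is a weight `λ + b γ + δ n`, `δ > 0`, on which the generator is
  the constant `b lam0` (`weightDrift_lyapunov`). As `v ↦ (1 - exp (-ε v)) / ε` is concave with
  slope in `[0, 1]` for `v ≥ 0`, the drift of the saturated weight is at most `b lam0`, and Fatou's
  lemma bounds the mean at time `t` by `lam0 + b lam0 t` (`IsBufferHawkes.lintegral_lyapunov_le`).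
* This weight dominates all others, so that `ε → 0` gives Dynkin's formula for every weight
  (`IsBufferHawkes.dynkin_weight`, `IsBufferHawkes.dynkin_weight_of_real`).

The resulting integral equations make the means continuous and right-differentiable, and the closed
forms follow from uniqueness for linear systems (`linear_system_unique`).
-/

namespace BufferHawkes

variable {Ω : Type*} {mΩ : MeasurableSpace Ω}

/-! ### Measurability in time and state -/

/-- A right-continuous process is jointly measurable in time and `ω`. Time is a real number here,
with negative times sent to `0`, to match the time integrals of the martingale problem. -/
theorem measurable_uncurry_of_rightCts {E : Type*} [TopologicalSpace E]
    [TopologicalSpace.PseudoMetrizableSpace E] [MeasurableSpace E] [BorelSpace E]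
    {X : ℝ≥0 → Ω → E} (hmeas : ∀ t, Measurable (X t))
    (hcts : ∀ ω t, ContinuousWithinAt (fun s => X s ω) (Set.Ici t) t) :
    Measurable (fun p : ℝ × Ω => X p.1.toNNReal p.2) := by
  -- `s` is approximated from the right by the end point of the interval
  -- `[j / (k + 1), (j + 1) / (k + 1))` that contains it
  have h1 : ∀ r : ℕ → ℝ≥0, Measurable (fun q : ℕ × Ω => X (r q.1) q.2) := fun r =>
    measurable_from_prod_countable_right fun j => hmeas (r j)
  have h2 : ∀ k : ℕ, Measurable (fun p : ℝ × Ω => (⌊p.1.toNNReal * ((k : ℝ≥0) + 1)⌋₊, p.2)) :=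
    fun k => Measurable.prodMk (Nat.measurable_floor.comp
      ((measurable_real_toNNReal.comp measurable_fst).mul_const _)) measurable_snd
  refine measurable_of_tendsto_metrizable
    (fun k => (h1 fun j => ((j : ℝ≥0) + 1) / (k + 1)).comp (h2 k)) ?_
  · rw [tendsto_pi_nhds]
    intro p
    have hr : Tendsto (fun k : ℕ => ((⌊p.1.toNNReal * ((k : ℝ≥0) + 1)⌋₊ : ℝ≥0) + 1) / (k + 1))
        atTop (𝓝[Set.Ici p.1.toNNReal] p.1.toNNReal) := by
      generalize p.1.toNNReal = s
      have hk : ∀ k : ℕ, (0 : ℝ≥0) < (k : ℝ≥0) + 1 := fun k => by positivity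
      have hlow : ∀ k : ℕ, s ≤ ((⌊s * ((k : ℝ≥0) + 1)⌋₊ : ℝ≥0) + 1) / (k + 1) := fun k => by
        rw [le_div_iff₀ (hk k)]
        exact (Nat.lt_floor_add_one _).le
      refine tendsto_nhdsWithin_iff.2 ⟨?_, Eventually.of_forall hlow⟩
      refine tendsto_of_tendsto_of_tendsto_of_le_of_le tendsto_const_nhds
        (h := fun k : ℕ => s + 1 / ((k : ℝ≥0) + 1)) ?_ hlow fun k => ?_
      · have := (tendsto_const_nhds (x := s)).add
          (tendsto_one_div_add_atTop_nhds_zero_nat (𝕜 := ℝ≥0))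
        simpa using this
      · rw [div_le_iff₀ (hk k), add_mul, one_div, inv_mul_cancel₀ (hk k).ne']
        gcongr
        exact Nat.floor_le (zero_le)
    exact (hcts p.2 p.1.toNNReal).tendsto.comp hr

/-! ### Dynkin's formula and its dominated limits -/

/-- Dynkin's formula at time `t` for the process `X`: `E f(X_t) = E f(X_0) + E ∫₀ᵗ g(X_s) ds`, all
three terms being absolutely convergent. For a solution of a martingale problem `g` is the
generator applied to `f`. The last term is an integral over the product of time and `Ω`, so that
dominated convergence applies to it in one step. -/
structure Dynkin (μ : Measure Ω) (X : ℝ≥0 → Ω → ℝ × ℕ × ℕ) (t : ℝ≥0)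
    (f g : ℝ × ℕ × ℕ → ℝ) : Prop where
  integrable_zero : Integrable (fun ω => f (X 0 ω)) μ
  integrable : Integrable (fun ω => f (X t ω)) μ
  integrable_drift : Integrable (fun p : ℝ × Ω => g (X p.1.toNNReal p.2))
    ((volume.restrict (Set.Ioc 0 (t : ℝ))).prod μ)
  integral_eq : ∫ ω, f (X t ω) ∂μ = ∫ ω, f (X 0 ω) ∂μ +
    ∫ p : ℝ × Ω, g (X p.1.toNNReal p.2) ∂((volume.restrict (Set.Ioc 0 (t : ℝ))).prod μ)

namespace Dynkin

variable {μ : Measure Ω} {X : ℝ≥0 → Ω → ℝ × ℕ × ℕ} {t : ℝ≥0}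
  {f g f' g' : ℝ × ℕ × ℕ → ℝ}

theorem const [IsFiniteMeasure μ] (C : ℝ) : Dynkin μ X t (fun _ => C) (fun _ => 0) where
  integrable_zero := integrable_const _
  integrable := integrable_const _
  integrable_drift := integrable_const _
  integral_eq := by simp

theorem sub (h : Dynkin μ X t f g) (h' : Dynkin μ X t f' g') :
    Dynkin μ X t (fun x => f x - f' x) (fun x => g x - g' x) where
  integrable_zero := h.integrable_zero.sub h'.integrable_zero
  integrable := h.integrable.sub h'.integrable
  integrable_drift := h.integrable_drift.sub h'.integrable_drift
  integral_eq := by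
    rw [integral_sub h.integrable h'.integrable,
      integral_sub h.integrable_zero h'.integrable_zero,
      integral_sub h.integrable_drift h'.integrable_drift, h.integral_eq, h'.integral_eq]
    ring

theorem const_mul (h : Dynkin μ X t f g) (C : ℝ) :
    Dynkin μ X t (fun x => C * f x) (fun x => C * g x) where
  integrable_zero := h.integrable_zero.const_mul C
  integrable := h.integrable.const_mul C
  integrable_drift := h.integrable_drift.const_mul C
  integral_eq := by
    rw [integral_const_mul, integral_const_mul, integral_const_mul, h.integral_eq]
    ring

/-- Dynkin's formula passes to pointwise limits that are dominated, separately for the functions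
and for their drifts. Convergence and bounds are needed on states of nonnegative intensity only. -/
theorem of_tendsto {fk gk : ℕ → ℝ × ℕ × ℕ → ℝ} {F G : ℝ × ℕ × ℕ → ℝ}
    (hnn : ∀ s ω, 0 ≤ (X s ω).1) (h : ∀ k, Dynkin μ X t (fk k) (gk k))
    (hf : ∀ x : ℝ × ℕ × ℕ, 0 ≤ x.1 → Tendsto (fun k => fk k x) atTop (𝓝 (f x)))
    (hg : ∀ x : ℝ × ℕ × ℕ, 0 ≤ x.1 → Tendsto (fun k => gk k x) atTop (𝓝 (g x)))
    (hF : ∀ k, ∀ x : ℝ × ℕ × ℕ, 0 ≤ x.1 → |fk k x| ≤ F x)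
    (hG : ∀ k, ∀ x : ℝ × ℕ × ℕ, 0 ≤ x.1 → |gk k x| ≤ G x)
    (hF0 : Integrable (fun ω => F (X 0 ω)) μ) (hFt : Integrable (fun ω => F (X t ω)) μ)
    (hGt : Integrable (fun p : ℝ × Ω => G (X p.1.toNNReal p.2))
      ((volume.restrict (Set.Ioc 0 (t : ℝ))).prod μ)) :
    Dynkin μ X t f g := by
  have key : ∀ {α : Type _} {mα : MeasurableSpace α} {ν : Measure α} {uk : ℕ → α → ℝ}
      {u U : α → ℝ}, (∀ k, Integrable (uk k) ν) → Integrable U ν → (∀ k y, |uk k y| ≤ U y) →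
      (∀ y, Tendsto (fun k => uk k y) atTop (𝓝 (u y))) →
      Integrable u ν ∧ Tendsto (fun k => ∫ y, uk k y ∂ν) atTop (𝓝 (∫ y, u y ∂ν)) := by
    intro α mα ν uk u U h1 h2 h3 h4
    refine ⟨Integrable.mono' h2 (aestronglyMeasurable_of_tendsto_ae atTop
      (fun k => (h1 k).aestronglyMeasurable) (ae_of_all _ h4)) (ae_of_all _ fun y => ?_),
      tendsto_integral_of_dominated_convergence U (fun k => (h1 k).aestronglyMeasurable) h2
        (fun k => ae_of_all _ fun y => h3 k y) (ae_of_all _ h4)⟩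
    exact le_of_tendsto ((h4 y).abs) (Eventually.of_forall fun k => h3 k y)
  obtain ⟨i0, l0⟩ := key (fun k => (h k).integrable_zero) hF0 (fun k ω => hF k _ (hnn _ _))
    (fun ω => hf _ (hnn _ _))
  obtain ⟨it, lt⟩ := key (fun k => (h k).integrable) hFt (fun k ω => hF k _ (hnn _ _))
    (fun ω => hf _ (hnn _ _))
  obtain ⟨ig, lg⟩ := key (fun k => (h k).integrable_drift) hGt (fun k ω => hG k _ (hnn _ _))
    (fun ω => hg _ (hnn _ _))
  refine ⟨i0, it, ig, tendsto_nhds_unique lt ?_⟩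
  simp_rw [fun k => (h k).integral_eq]
  exact l0.add lg

end Dynkin

/-! ### Test functions -/

theorem measurable_of_measurable_fst {f : ℝ × ℕ × ℕ → ℝ}
    (h : ∀ γ n : ℕ, Measurable (fun l : ℝ => f (l, γ, n))) : Measurable f :=
  measurable_from_prod_countable_left fun y => h y.1 y.2

theorem IsTestFunction.measurable {f : ℝ × ℕ × ℕ → ℝ} (hf : IsTestFunction f) : Measurable f :=
  measurable_of_measurable_fst fun γ n => (hf.contDiff γ n).continuous.measurable

theorem IsTestFunction.measurable_generator {f : ℝ × ℕ × ℕ → ℝ} (hf : IsTestFunction f)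
    (lam0 a b c d : ℝ) : Measurable (generator lam0 a b c d f) := by
  refine measurable_of_measurable_fst fun γ n => ?_
  have h : ∀ γ n : ℕ, Measurable (fun l : ℝ => f (l, γ, n)) := fun γ n =>
    (hf.contDiff γ n).continuous.measurable
  have h' : Measurable (fun l : ℝ => f (l + a, γ - 1, n + 1)) :=
    (h (γ - 1) (n + 1)).comp (measurable_id.add_const a)
  have hd : Measurable (deriv (fun l : ℝ => f (l, γ, n))) := measurable_deriv _
  have h1 := h γ n
  have h2 := h (γ + 1) n
  have h3 := h (γ - 1) n
  have m1 : Measurable (fun l : ℝ => b * (lam0 - l) * deriv (fun l : ℝ => f (l, γ, n)) l) :=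
    ((measurable_const.sub measurable_id).const_mul b).mul hd
  have m2 : Measurable (fun l : ℝ => l * (f (l, γ + 1, n) - f (l, γ, n))) :=
    measurable_id.mul (h2.sub h1)
  have m3 : Measurable (fun l : ℝ => d * (γ : ℝ) * (f (l, γ - 1, n) - f (l, γ, n))) :=
    (h3.sub h1).const_mul _
  have m4 : Measurable (fun l : ℝ => c * (γ : ℝ) * (f (l + a, γ - 1, n + 1) - f (l, γ, n))) :=
    (h'.sub h1).const_mul _
  exact ((m1.add m2).add m3).add m4

section TestFunctions

variable {μ : Measure Ω} {ℱ : Filtration ℝ≥0 mΩ} {lam0 a b c d : ℝ}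
  {Λ : ℝ≥0 → Ω → ℝ} {Γ N : ℝ≥0 → Ω → ℕ}

theorem IsBufferHawkes.measurable (hX : IsBufferHawkes μ ℱ lam0 a b c d Λ Γ N) (t : ℝ≥0) :
    Measurable (fun ω => (Λ t ω, Γ t ω, N t ω)) :=
  (hX.adapted t).mono (ℱ.le t) le_rfl

theorem IsBufferHawkes.measurable_uncurry (hX : IsBufferHawkes μ ℱ lam0 a b c d Λ Γ N) :
    Measurable (fun p : ℝ × Ω =>
      (Λ p.1.toNNReal p.2, Γ p.1.toNNReal p.2, N p.1.toNNReal p.2)) :=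
  measurable_uncurry_of_rightCts (X := fun t ω => (Λ t ω, Γ t ω, N t ω)) hX.measurable hX.rightCts

/-- The martingale property in expectation. The bounds `M`, `M'` concern states of nonnegative
intensity, the only ones that the process visits. -/
theorem IsBufferHawkes.dynkin_of_isTestFunction [IsProbabilityMeasure μ]
    (hX : IsBufferHawkes μ ℱ lam0 a b c d Λ Γ N)
    {f : ℝ × ℕ × ℕ → ℝ} (hf : IsTestFunction f)
    {M : ℝ} (hM : ∀ x : ℝ × ℕ × ℕ, 0 ≤ x.1 → |f x| ≤ M) {M' : ℝ}
    (hM' : ∀ x : ℝ × ℕ × ℕ, 0 ≤ x.1 → |generator lam0 a b c d f x| ≤ M') (t : ℝ≥0) :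
    Dynkin μ (fun t ω => (Λ t ω, Γ t ω, N t ω)) t f (generator lam0 a b c d f) := by
  have hi : ∀ s, Integrable (fun ω => f (Λ s ω, Γ s ω, N s ω)) μ := fun s =>
    Integrable.of_bound (hf.measurable.comp (hX.measurable s)).aestronglyMeasurable M
      (ae_of_all _ fun ω => hM _ (hX.nonneg _ _))
  have hg : Integrable (fun p : ℝ × Ω => generator lam0 a b c d f
      (Λ p.1.toNNReal p.2, Γ p.1.toNNReal p.2, N p.1.toNNReal p.2))
      ((volume.restrict (Set.Ioc 0 (t : ℝ))).prod μ) :=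
    Integrable.of_bound ((hf.measurable_generator lam0 a b c d).comp
      hX.measurable_uncurry).aestronglyMeasurable M' (ae_of_all _ fun p => hM' _ (hX.nonneg _ _))
  refine ⟨hi 0, hi t, hg, ?_⟩
  have hm := (hX.martingale f hf).setIntegral_eq (zero_le : 0 ≤ t) (MeasurableSet.univ)
  simp only [setIntegral_univ, NNReal.coe_zero, intervalIntegral.integral_same, sub_self,
    integral_zero] at hm
  simp_rw [intervalIntegral.integral_of_le t.coe_nonneg] at hm
  have hI : Integrable (fun ω => ∫ s in Set.Ioc 0 (t : ℝ), generator lam0 a b c d f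
      (Λ s.toNNReal ω, Γ s.toNNReal ω, N s.toNNReal ω)) μ := hg.integral_prod_right
  have hd : Integrable (fun ω => f (Λ t ω, Γ t ω, N t ω) - f (Λ 0 ω, Γ 0 ω, N 0 ω)) μ :=
    (hi t).sub (hi 0)
  rw [integral_sub hd hI, integral_sub (hi t) (hi 0)] at hm
  rw [integral_prod_symm _ hg]
  linarith

end TestFunctions

/-! ### The Laplace transform of the state -/

/-- The linear functional `α λ + β γ + δ n` of the state. -/
def weight (α β δ : ℝ) (x : ℝ × ℕ × ℕ) : ℝ := α * x.1 + β * x.2.1 + δ * x.2.2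

theorem measurable_weight (α β δ : ℝ) : Measurable (weight α β δ) :=
  measurable_of_measurable_fst fun γ n => by unfold weight; dsimp only; fun_prop

/-- A compactly supported `C¹` function with values in `[0, 1]`, equal to `1` at `0`. -/
theorem exists_cutoff : ∃ φ : ℝ → ℝ, ∃ C : ℝ, ContDiff ℝ 1 φ ∧ HasCompactSupport φ ∧ φ 0 = 1 ∧
    (∀ x, 0 ≤ φ x) ∧ (∀ x, φ x ≤ 1) ∧ 0 ≤ C ∧ ∀ x, |deriv φ x| ≤ C := by
  let φ : ContDiffBump (0 : ℝ) := ⟨1, 2, one_pos, one_lt_two⟩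
  have hc : ContDiff ℝ 1 φ := φ.contDiff
  obtain ⟨C, hC⟩ := (φ.hasCompactSupport.deriv (𝕜 := ℝ)).exists_bound_of_continuous
    (hc.continuous_deriv le_rfl)
  exact ⟨φ, C, hc, φ.hasCompactSupport, φ.one_of_mem_closedBall (by simp [φ]),
    fun x => φ.nonneg, fun x => φ.le_one, (norm_nonneg _).trans (hC 0), hC⟩

/-- The generator applied to `exp (-(α λ + β γ + δ n))`, in closed form. -/
noncomputable def expDrift (lam0 a b c d α β δ : ℝ) (x : ℝ × ℕ × ℕ) : ℝ :=
  Real.exp (-weight α β δ x) *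
    (-(α * (b * (lam0 - x.1))) + x.1 * (Real.exp (-β) - 1) + d * x.2.1 * (Real.exp β - 1)
      + c * x.2.1 * (Real.exp (-(α * a - β + δ)) - 1))

/-- The generator applied to `exp (-(α λ + β γ + δ n)) χ`, where `χ` takes the values
`v`, `vin`, `vout`, `vex` at the state and after an arrival, a cancellation and an execution,
and has `λ`-derivative `v'`. -/
theorem generator_exp_mul {lam0 a b c d α β δ : ℝ} {χ : ℝ × ℕ × ℕ → ℝ} {x : ℝ × ℕ × ℕ} {v' : ℝ}
    (hχ : HasDerivAt (fun l : ℝ => χ (l, x.2.1, x.2.2)) v' x.1) :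
    generator lam0 a b c d (fun y => Real.exp (-weight α β δ y) * χ y) x =
      Real.exp (-weight α β δ x) *
        (b * (lam0 - x.1) * (v' - α * χ x)
          + x.1 * (Real.exp (-β) * χ (x.1, x.2.1 + 1, x.2.2) - χ x)
          + d * x.2.1 * (Real.exp β * χ (x.1, x.2.1 - 1, x.2.2) - χ x)
          + c * x.2.1 * (Real.exp (-(α * a - β + δ)) * χ (x.1 + a, x.2.1 - 1, x.2.2 + 1)
            - χ x)) := by
  obtain ⟨l, γ, n⟩ := x
  dsimp only at hχ ⊢
  have hder : deriv (fun l : ℝ => Real.exp (-weight α β δ (l, γ, n)) * χ (l, γ, n)) l =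
      Real.exp (-weight α β δ (l, γ, n)) * (v' - α * χ (l, γ, n)) := by
    have h1 : HasDerivAt (fun l : ℝ => -weight α β δ (l, γ, n)) (-(α * 1)) l :=
      ((((hasDerivAt_id l).const_mul α).add_const (β * (γ : ℝ))).add_const (δ * (n : ℝ))).neg
    refine (h1.exp.mul hχ).deriv.trans ?_
    ring
  unfold generator
  dsimp only
  rw [hder]
  have e1 : Real.exp (-weight α β δ (l, γ + 1, n)) =
      Real.exp (-weight α β δ (l, γ, n)) * Real.exp (-β) := by
    rw [← Real.exp_add]; congr 1; simp only [weight]; push_cast; ring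
  rw [e1]
  -- at `γ = 0` the rates of cancellation and execution vanish, so
  -- the truncated `γ - 1` does not matter
  rcases γ with _ | γ
  · simp only [CharP.cast_eq_zero]
    ring
  · have e2 : Real.exp (-weight α β δ (l, γ + 1 - 1, n)) =
        Real.exp (-weight α β δ (l, γ + 1, n)) * Real.exp β := by
      rw [← Real.exp_add]; congr 1; simp only [weight, Nat.add_sub_cancel]; push_cast; ring
    have e3 : Real.exp (-weight α β δ (l + a, γ + 1 - 1, n + 1)) =
        Real.exp (-weight α β δ (l, γ + 1, n)) * Real.exp (-(α * a - β + δ)) := by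
      rw [← Real.exp_add]; congr 1; simp only [weight, Nat.add_sub_cancel]; push_cast; ring
    rw [e2, e3]
    ring

theorem weight_nonneg {α β δ : ℝ} (hα : 0 ≤ α) (hβ : 0 ≤ β) (hδ : 0 ≤ δ) {x : ℝ × ℕ × ℕ}
    (hx : 0 ≤ x.1) : 0 ≤ weight α β δ x := by
  unfold weight; positivity

/-- `exp (-V)` dominates every affine function of the intensity and the buffer size. -/
theorem exp_neg_weight_mul_le {α β δ : ℝ} (hα : 0 < α) (hβ : 0 < β) (hδ : 0 ≤ δ)
    {A B D : ℝ} (hA : 0 ≤ A) (hB : 0 ≤ B) (hD : 0 ≤ D) {x : ℝ × ℕ × ℕ} (hx : 0 ≤ x.1) :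
    Real.exp (-weight α β δ x) * (A + B * x.1 + D * x.2.1) ≤ A + B / α + D / β := by
  have hγ : (0 : ℝ) ≤ x.2.1 := Nat.cast_nonneg _
  have hn : 0 ≤ δ * (x.2.2 : ℝ) := by positivity
  have hE := Real.add_one_le_exp (weight α β δ x)
  have hV : weight α β δ x = α * x.1 + β * x.2.1 + δ * x.2.2 := rfl
  have h1 : α * x.1 ≤ Real.exp (weight α β δ x) := by nlinarith [mul_nonneg hβ.le hγ]
  have h2 : β * x.2.1 ≤ Real.exp (weight α β δ x) := by nlinarith [mul_nonneg hα.le hx]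
  have h3 : 1 ≤ Real.exp (weight α β δ x) :=
    Real.one_le_exp (weight_nonneg hα.le hβ.le hδ hx)
  rw [Real.exp_neg, inv_mul_le_iff₀ (Real.exp_pos _)]
  have h4 : B * x.1 ≤ Real.exp (weight α β δ x) * (B / α) := by
    rw [mul_div_assoc', le_div_iff₀ hα]; nlinarith
  have h5 : D * x.2.1 ≤ Real.exp (weight α β δ x) * (D / β) := by
    rw [mul_div_assoc', le_div_iff₀ hβ]; nlinarith
  nlinarith

/-- The cutoff `φ (λ / (k + 1)) 1_{γ ≤ k} 1_{n ≤ k}`. In the discrete coordinates an indicator is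
already smooth, and `k + 1` keeps the scale positive at `k = 0`. -/
noncomputable def cutoff (φ : ℝ → ℝ) (k : ℕ) (x : ℝ × ℕ × ℕ) : ℝ :=
  φ (x.1 / (k + 1)) * if x.2.1 ≤ k ∧ x.2.2 ≤ k then 1 else 0

section Cutoff

variable {φ : ℝ → ℝ}

theorem cutoff_nonneg (h : ∀ x, 0 ≤ φ x) (k : ℕ) (x : ℝ × ℕ × ℕ) : 0 ≤ cutoff φ k x := by
  unfold cutoff
  split_ifs
  · simpa using h _
  · simp

theorem cutoff_le_one (h : ∀ x, φ x ≤ 1) (k : ℕ) (x : ℝ × ℕ × ℕ) : cutoff φ k x ≤ 1 := by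
  unfold cutoff
  split_ifs
  · simpa using h _
  · simp

theorem tendsto_cutoff (hφ : Continuous φ) (h0 : φ 0 = 1) (x : ℝ × ℕ × ℕ) :
    Tendsto (fun k => cutoff φ k x) atTop (𝓝 1) := by
  have h1 : Tendsto (fun k : ℕ => φ (x.1 / ((k : ℝ) + 1))) atTop (𝓝 1) := by
    have := (hφ.tendsto 0).comp (tendsto_const_div_atTop_nhds_zero_nat x.1 |>.comp
      (tendsto_add_atTop_nat 1))
    rw [h0] at this
    refine this.congr fun k => ?_
    simp
  refine h1.congr' ?_
  filter_upwards [eventually_ge_atTop x.2.1, eventually_ge_atTop x.2.2] with k h h'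
  simp [cutoff, h, h']

theorem exists_hasDerivAt_cutoff (hφ : ContDiff ℝ 1 φ) {C : ℝ} (hC : ∀ x, |deriv φ x| ≤ C)
    (hC0 : 0 ≤ C) (k : ℕ) (x : ℝ × ℕ × ℕ) :
    ∃ v', HasDerivAt (fun l : ℝ => cutoff φ k (l, x.2.1, x.2.2)) v' x.1 ∧
      |v'| ≤ C / (k + 1) := by
  have h : HasDerivAt (fun l : ℝ => φ (l / (k + 1)))
      (deriv φ (x.1 / (k + 1)) * (1 / (k + 1))) x.1 :=
    ((hφ.differentiable one_ne_zero).differentiableAt.hasDerivAt).comp x.1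
      ((hasDerivAt_id x.1).div_const ((k : ℝ) + 1))
  refine ⟨_, h.mul_const (if x.2.1 ≤ k ∧ x.2.2 ≤ k then 1 else 0), ?_⟩
  have hk : (0 : ℝ) ≤ 1 / (k + 1) := by positivity
  rw [abs_mul, abs_mul, abs_of_nonneg hk]
  have : |if x.2.1 ≤ k ∧ x.2.2 ≤ k then (1 : ℝ) else 0| ≤ 1 := by split_ifs <;> simp
  calc _ ≤ C * (1 / ((k : ℝ) + 1)) * 1 := by
        gcongr
        exact hC _
    _ = C / (k + 1) := by ring

theorem isTestFunction_exp_mul_cutoff (hφ : ContDiff ℝ 1 φ) (hs : HasCompactSupport φ)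
    (α β δ : ℝ) (k : ℕ) :
    IsTestFunction (fun x => Real.exp (-weight α β δ x) * cutoff φ k x) where
  compactSupport := by
    have hk : ((k : ℝ) + 1) ≠ 0 := by positivity
    have hs' : HasCompactSupport fun l : ℝ => φ (l / (k + 1)) := by
      simpa only [div_eq_mul_inv, mul_comm, smul_eq_mul, Function.comp_def] using
        hs.comp_smul (inv_ne_zero hk)
    refine HasCompactSupport.of_support_subset_isCompact
      (hs'.isCompact.prod ((Set.finite_Iic k).isCompact.prod (Set.finite_Iic k).isCompact)) ?_
    intro x hx
    have hx : Real.exp (-weight α β δ x) * cutoff φ k x ≠ 0 := hx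
    have h1 : φ (x.1 / (k + 1)) ≠ 0 := fun h => hx (by simp [cutoff, h])
    have h2 : x.2.1 ≤ k ∧ x.2.2 ≤ k := by
      by_contra h
      exact hx (by simp [cutoff, h])
    exact ⟨subset_tsupport _ h1, h2.1, h2.2⟩
  contDiff γ n := by
    have h : ContDiff ℝ 1 fun l : ℝ => φ (l / (k + 1)) := hφ.comp (contDiff_id.div_const _)
    have hw : ContDiff ℝ 1 fun l : ℝ => α * l + β * (γ : ℝ) + δ * (n : ℝ) := by fun_prop
    exact hw.neg.exp.mul
      (h.mul (contDiff_const (c := if γ ≤ k ∧ n ≤ k then (1 : ℝ) else 0)))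

end Cutoff

/-- Dynkin's formula for `exp (-V)`, `V = α λ + β γ + δ n`. Cutting `exp (-V)` off gives test
functions. The jump rates grow linearly while the factor `exp (-V)` decays exponentially, so the
generators of these test functions are bounded uniformly in the cutoff. -/
theorem IsBufferHawkes.dynkin_exp {μ : Measure Ω} [IsProbabilityMeasure μ]
    {ℱ : Filtration ℝ≥0 mΩ} {lam0 a b c d : ℝ} {Λ : ℝ≥0 → Ω → ℝ} {Γ N : ℝ≥0 → Ω → ℕ}
    (hX : IsBufferHawkes μ ℱ lam0 a b c d Λ Γ N)
    (hlam0 : 0 ≤ lam0) (hb : 0 ≤ b) (hc : 0 ≤ c) (hd : 0 ≤ d)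
    {α β δ : ℝ} (hα : 0 < α) (hβ : 0 < β) (hδ : 0 ≤ δ) (t : ℝ≥0) :
    Dynkin μ (fun t ω => (Λ t ω, Γ t ω, N t ω)) t (fun x => Real.exp (-weight α β δ x))
      (expDrift lam0 a b c d α β δ) := by
  obtain ⟨φ, C, hφ, hs, h0, hnn, hle, hC0, hC⟩ := exists_cutoff
  choose v' hv' hv'C using fun k => exists_hasDerivAt_cutoff hφ hC hC0 k
  have hχ : ∀ k x, |cutoff φ k x| ≤ 1 := fun k x => by
    rw [abs_of_nonneg (cutoff_nonneg hnn k x)]; exact cutoff_le_one hle k x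
  have hv1 : ∀ k x, |v' k x| ≤ C := fun k x => (hv'C k x).trans
    (div_le_self hC0 (by norm_cast; omega))
  have hgen : ∀ k x, generator lam0 a b c d
      (fun y => Real.exp (-weight α β δ y) * cutoff φ k y) x = _ :=
    fun k x => generator_exp_mul (hv' k x)
  have hbd : ∀ {p u w : ℝ}, 0 ≤ p → |u| ≤ 1 → |w| ≤ 1 → |p * u - w| ≤ p + 1 := by
    intro p u w hp hu hw
    refine (abs_sub _ _).trans ?_
    rw [abs_mul, abs_of_nonneg hp]
    nlinarith [mul_le_mul_of_nonneg_left hu hp]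
  obtain ⟨M, hM⟩ : ∃ M, ∀ k, ∀ x : ℝ × ℕ × ℕ, 0 ≤ x.1 → |generator lam0 a b c d
      (fun y => Real.exp (-weight α β δ y) * cutoff φ k y) x| ≤ M := by
    set A := b * lam0 * (C + α) with hA
    set B := b * (C + α) + (Real.exp (-β) + 1) with hB
    set D := d * (Real.exp β + 1) + c * (Real.exp (-(α * a - β + δ)) + 1) with hD
    refine ⟨A + B / α + D / β, fun k x hx => ?_⟩
    rw [hgen, abs_mul, abs_of_pos (Real.exp_pos _)]
    have hγ : (0 : ℝ) ≤ x.2.1 := Nat.cast_nonneg _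
    have key : ∀ {r R u U : ℝ}, |r| ≤ R → |u| ≤ U → |r * u| ≤ R * U := fun {r R u U} h1 h2 => by
      rw [abs_mul]; exact mul_le_mul h1 h2 (abs_nonneg _) ((abs_nonneg _).trans h1)
    have k1 : |b * (lam0 - x.1) * (v' k x - α * cutoff φ k x)| ≤
        (b * (lam0 + x.1)) * (C + α) := by
      refine key ?_ ((abs_sub _ _).trans (add_le_add (hv1 k x) ?_))
      · rw [abs_mul, abs_of_nonneg hb]
        gcongr
        exact (abs_sub _ _).trans (by rw [abs_of_nonneg hlam0, abs_of_nonneg hx])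
      · rw [abs_mul, abs_of_pos hα]
        nlinarith [hχ k x]
    have k2 := key (abs_of_nonneg hx).le
      (hbd (Real.exp_pos (-β)).le (hχ k (x.1, x.2.1 + 1, x.2.2)) (hχ k x))
    have k3 := key (abs_of_nonneg (mul_nonneg hd hγ)).le
      (hbd (Real.exp_pos β).le (hχ k (x.1, x.2.1 - 1, x.2.2)) (hχ k x))
    have k4 := key (abs_of_nonneg (mul_nonneg hc hγ)).le
      (hbd (Real.exp_pos (-(α * a - β + δ))).le (hχ k (x.1 + a, x.2.1 - 1, x.2.2 + 1)) (hχ k x))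
    have hsum := (abs_add_le _ _).trans (add_le_add ((abs_add_le _ _).trans
      (add_le_add ((abs_add_le _ _).trans (add_le_add k1 k2)) k3)) k4)
    refine (mul_le_mul_of_nonneg_left hsum (Real.exp_pos _).le).trans ?_
    have := exp_neg_weight_mul_le hα hβ hδ (x := x)
      (A := A) (B := B) (D := D) (by positivity) (by positivity) (by positivity) hx
    refine le_trans (le_of_eq ?_) this
    rw [hA, hB, hD]
    ring
  have hE1 : ∀ x : ℝ × ℕ × ℕ, 0 ≤ x.1 → Real.exp (-weight α β δ x) ≤ 1 := fun x hx =>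
    Real.exp_le_one_iff.2 (neg_nonpos.2 (weight_nonneg hα.le hβ.le hδ hx))
  have hF : ∀ k, ∀ x : ℝ × ℕ × ℕ, 0 ≤ x.1 →
      |Real.exp (-weight α β δ x) * cutoff φ k x| ≤ 1 := fun k x hx => by
    rw [abs_mul, abs_of_pos (Real.exp_pos _)]
    exact mul_le_one₀ (hE1 x hx) (abs_nonneg _) (hχ k x)
  have hχt : ∀ x, Tendsto (fun k => cutoff φ k x) atTop (𝓝 1) :=
    tendsto_cutoff hφ.continuous h0
  refine Dynkin.of_tendsto (F := fun _ => 1) (G := fun _ => M) hX.nonneg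
    (fun k => hX.dynkin_of_isTestFunction (isTestFunction_exp_mul_cutoff hφ hs α β δ k)
      (hF k) (hM k) t) ?_ ?_ hF hM (integrable_const _) (integrable_const _) (integrable_const _)
  · intro x _
    simpa using (hχt x).const_mul (Real.exp (-weight α β δ x))
  · intro x _
    simp_rw [hgen]
    have hv0 : Tendsto (fun k => v' k x) atTop (𝓝 0) := by
      refine squeeze_zero_norm (fun k => hv'C k x) ?_
      have := (tendsto_const_div_atTop_nhds_zero_nat C).comp (tendsto_add_atTop_nat 1)
      refine this.congr fun k => ?_
      simp
    have hd : ∀ (p : ℝ) (y : ℝ × ℕ × ℕ),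
        Tendsto (fun k => p * cutoff φ k y - cutoff φ k x) atTop (𝓝 (p * 1 - 1)) :=
      fun p y => ((hχt y).const_mul p).sub (hχt x)
    have key := ((((((hv0.sub ((hχt x).const_mul α)).const_mul (b * (lam0 - x.1))).add
      ((hd (Real.exp (-β)) (x.1, x.2.1 + 1, x.2.2)).const_mul x.1)).add
      ((hd (Real.exp β) (x.1, x.2.1 - 1, x.2.2)).const_mul (d * x.2.1))).add
      ((hd (Real.exp (-(α * a - β + δ))) (x.1 + a, x.2.1 - 1, x.2.2 + 1)).const_mul
        (c * x.2.1))).const_mul (Real.exp (-weight α β δ x)))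
    convert key using 2
    unfold expDrift
    ring

/-! ### Saturated weights -/

theorem one_sub_exp_div_le {ε : ℝ} (hε : 0 < ε) (u : ℝ) : (1 - Real.exp (-(ε * u))) / ε ≤ u := by
  rw [div_le_iff₀ hε]
  linarith [Real.add_one_le_exp (-(ε * u))]

theorem abs_one_sub_exp_div_le {ε : ℝ} (hε : 0 < ε) (hε1 : ε ≤ 1) (u : ℝ) :
    |(1 - Real.exp (-(ε * u))) / ε| ≤ |u| * Real.exp |u| := by
  have h1 := one_sub_exp_div_le hε u
  have h2 : (1 : ℝ) ≤ Real.exp |u| := Real.one_le_exp (abs_nonneg u)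
  have h3 : -(ε * u) ≤ |u| := by
    have : |ε * u| ≤ |u| := by
      rw [abs_mul, abs_of_pos hε]
      exact mul_le_of_le_one_left (abs_nonneg u) hε1
    linarith [neg_abs_le (ε * u)]
  refine abs_le.2 ⟨?_, h1.trans ((le_abs_self u).trans
    (le_mul_of_one_le_right (abs_nonneg u) h2))⟩
  rw [le_div_iff₀ hε]
  -- `exp x - 1 ≤ x exp x`, applied at `x = -ε u`
  have h4 : Real.exp (-(ε * u)) - 1 ≤ -(ε * u) * Real.exp (-(ε * u)) := by
    have := mul_le_mul_of_nonneg_left (Real.add_one_le_exp (ε * u)) (Real.exp_pos (-(ε * u))).le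
    rw [← Real.exp_add, neg_add_cancel, Real.exp_zero] at this
    linarith
  have h5 : -(ε * u) * Real.exp (-(ε * u)) ≤ (ε * |u|) * Real.exp |u| := by
    have h6 : -(ε * u) ≤ ε * |u| := by nlinarith [neg_abs_le u]
    exact mul_le_mul h6 (Real.exp_le_exp.2 h3) (Real.exp_pos _).le (by positivity)
  linarith

theorem tendsto_one_sub_exp_div (u : ℝ) :
    Tendsto (fun k : ℕ => (1 - Real.exp (-(1 / ((k : ℝ) + 1) * u))) / (1 / ((k : ℝ) + 1)))
      atTop (𝓝 u) := by
  have h0 : Tendsto (fun k : ℕ => 1 / ((k : ℝ) + 1)) atTop (𝓝[≠] 0) :=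
    tendsto_nhdsWithin_iff.2 ⟨tendsto_one_div_add_atTop_nhds_zero_nat,
      Eventually.of_forall fun k => by simp only [Set.mem_compl_iff, Set.mem_singleton_iff]
                                       positivity⟩
  have h1 : HasDerivAt (fun ε : ℝ => 1 - Real.exp (-(ε * u))) u 0 := by
    have := (((hasDerivAt_id (0 : ℝ)).mul_const u).neg.exp).const_sub 1
    simpa using this
  have := (hasDerivAt_iff_tendsto_slope_zero.1 h1).comp h0
  refine this.congr fun k => ?_
  simp [div_eq_inv_mul]

/-- The saturated weight `(1 - exp (-ε V)) / ε`, `V = α λ + β γ + δ n`. It is bounded where `V ≥ 0`,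
lies below `V`, and tends to `V` as `ε → 0`. -/
noncomputable def satWeight (α β δ ε : ℝ) (x : ℝ × ℕ × ℕ) : ℝ :=
  (1 - Real.exp (-(ε * weight α β δ x))) / ε

/-- The generator applied to `satWeight α β δ ε`, in closed form. -/
noncomputable def satDrift (lam0 a b c d α β δ ε : ℝ) (x : ℝ × ℕ × ℕ) : ℝ :=
  Real.exp (-(ε * weight α β δ x)) *
    (α * (b * (lam0 - x.1)) + x.1 * ((1 - Real.exp (-(ε * β))) / ε)
      + d * x.2.1 * ((1 - Real.exp (-(ε * (-β)))) / ε)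
      + c * x.2.1 * ((1 - Real.exp (-(ε * (α * a - β + δ)))) / ε))

/-- The generator applied to `α λ + β γ + δ n`, in closed form. -/
def weightDrift (lam0 a b c d α β δ : ℝ) (x : ℝ × ℕ × ℕ) : ℝ :=
  α * (b * (lam0 - x.1)) + x.1 * β + d * x.2.1 * (-β) + c * x.2.1 * (α * a - β + δ)

theorem weight_smul (ε α β δ : ℝ) (x : ℝ × ℕ × ℕ) :
    weight (ε * α) (ε * β) (ε * δ) x = ε * weight α β δ x := by
  unfold weight; ring

theorem satWeight_nonneg {α β δ ε : ℝ} (hα : 0 ≤ α) (hβ : 0 ≤ β) (hδ : 0 ≤ δ) (hε : 0 < ε)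
    {x : ℝ × ℕ × ℕ} (hx : 0 ≤ x.1) : 0 ≤ satWeight α β δ ε x := by
  refine div_nonneg (sub_nonneg.2 (Real.exp_le_one_iff.2 (neg_nonpos.2 ?_))) hε.le
  exact mul_nonneg hε.le (weight_nonneg hα hβ hδ hx)

/-- Since `1 + u ≤ exp u`, the function `v ↦ (1 - exp (-ε v)) / ε` is concave with derivative
`exp (-ε v)`, so its drift is at most `exp (-ε V)` times that of `V`. -/
theorem satDrift_le {lam0 a b c d α β δ ε : ℝ} (hc : 0 ≤ c) (hd : 0 ≤ d) (hε : 0 < ε)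
    {x : ℝ × ℕ × ℕ} (hx : 0 ≤ x.1) :
    satDrift lam0 a b c d α β δ ε x ≤
      Real.exp (-(ε * weight α β δ x)) * weightDrift lam0 a b c d α β δ x := by
  unfold satDrift weightDrift
  -- the drift part is common to both sides; each jump part is an instance of `1 + u ≤ exp u`
  gcongr <;> exact one_sub_exp_div_le hε _

/-- The Lyapunov weight `λ + b γ + ((b (c + d) - a c) / c) n` has constant drift `b lam0`. The
stability condition `a c < b (c + d)` says that its last coefficient is positive. -/
theorem weightDrift_lyapunov {lam0 a b c d : ℝ} (hc : c ≠ 0) (x : ℝ × ℕ × ℕ) :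
    weightDrift lam0 a b c d 1 b ((b * (c + d) - a * c) / c) x = b * lam0 := by
  unfold weightDrift; field_simp; ring

section Moments

variable {μ : Measure Ω} [IsProbabilityMeasure μ]
    {ℱ : Filtration ℝ≥0 mΩ} {lam0 a b c d : ℝ} {Λ : ℝ≥0 → Ω → ℝ} {Γ N : ℝ≥0 → Ω → ℕ}

theorem IsBufferHawkes.dynkin_satWeight (hX : IsBufferHawkes μ ℱ lam0 a b c d Λ Γ N)
    (hlam0 : 0 ≤ lam0) (hb : 0 ≤ b) (hc : 0 ≤ c) (hd : 0 ≤ d)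
    {α β δ ε : ℝ} (hα : 0 < α) (hβ : 0 < β) (hδ : 0 ≤ δ) (hε : 0 < ε) (t : ℝ≥0) :
    Dynkin μ (fun t ω => (Λ t ω, Γ t ω, N t ω)) t (satWeight α β δ ε)
      (satDrift lam0 a b c d α β δ ε) := by
  have h := ((Dynkin.const 1).sub (hX.dynkin_exp hlam0 hb hc hd (mul_pos hε hα) (mul_pos hε hβ)
    (mul_nonneg hε.le hδ) t)).const_mul ε⁻¹
  convert h using 1
  · funext x
    rw [satWeight, weight_smul, div_eq_inv_mul]
  · funext x
    rw [satDrift, expDrift, weight_smul, mul_neg, neg_neg,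
      show ε * α * a - ε * β + ε * δ = ε * (α * a - β + δ) by ring]
    field_simp
    ring

theorem IsBufferHawkes.integral_initial (hX : IsBufferHawkes μ ℱ lam0 a b c d Λ Γ N)
    (f : ℝ × ℕ × ℕ → ℝ) : ∫ ω, f (Λ 0 ω, Γ 0 ω, N 0 ω) ∂μ = f (lam0, 0, 0) := by
  rw [integral_congr_ae (g := fun _ => f (lam0, 0, 0))]
  · simp
  · filter_upwards [hX.initial] with ω ⟨h1, h2, h3⟩
    rw [h1, h2, h3]

/-! ### Finiteness and linear relations of the first moments -/

/-- The saturated Lyapunov weight has drift at most `b lam0`, whatever `ε`; the bound on its mean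
passes to `ε → 0` by Fatou's lemma. -/
theorem IsBufferHawkes.lintegral_lyapunov_le (hX : IsBufferHawkes μ ℱ lam0 a b c d Λ Γ N)
    (hlam0 : 0 < lam0) (hb : 0 < b) (hc : 0 < c) (hd : 0 ≤ d) (hstab : a * c < b * (c + d))
    (t : ℝ≥0) :
    ∫⁻ ω, ENNReal.ofReal (weight 1 b ((b * (c + d) - a * c) / c) (Λ t ω, Γ t ω, N t ω)) ∂μ ≤
      ENNReal.ofReal (lam0 + b * lam0 * t) := by
  set δ := (b * (c + d) - a * c) / c with hδ
  have hδ0 : 0 ≤ δ := div_nonneg (by linarith) hc.le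
  have hε : ∀ k : ℕ, (0 : ℝ) < 1 / ((k : ℝ) + 1) := fun k => by positivity
  have hD := fun k : ℕ => hX.dynkin_satWeight hlam0.le hb.le hc.le hd one_pos hb hδ0 (hε k) t
  have hbound : ∀ k : ℕ, ∫⁻ ω, ENNReal.ofReal
      (satWeight 1 b δ (1 / ((k : ℝ) + 1)) (Λ t ω, Γ t ω, N t ω)) ∂μ ≤
        ENNReal.ofReal (lam0 + b * lam0 * t) := fun k => by
    rw [← ofReal_integral_eq_lintegral_ofReal (hD k).integrable (ae_of_all _ fun ω =>
      satWeight_nonneg zero_le_one hb.le hδ0 (hε k) (hX.nonneg _ _))]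
    refine ENNReal.ofReal_le_ofReal ?_
    rw [(hD k).integral_eq, hX.integral_initial]
    refine add_le_add ?_ ?_
    · refine (one_sub_exp_div_le (hε k) _).trans ?_
      simp [weight]
    · refine (integral_mono (hD k).integrable_drift (integrable_const (b * lam0))
        fun p => ?_).trans ?_
      · refine (satDrift_le hc.le hd (hε k) (hX.nonneg _ _)).trans ?_
        rw [hδ, weightDrift_lyapunov hc.ne', ← hδ]
        refine mul_le_of_le_one_left (by positivity) (Real.exp_le_one_iff.2 (neg_nonpos.2 ?_))
        exact mul_nonneg (hε k).le (weight_nonneg zero_le_one hb.le hδ0 (hX.nonneg _ _))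
      · rw [integral_const, ← Set.univ_prod_univ, measureReal_prod_prod]
        simp [mul_comm]
  refine le_trans (le_trans (lintegral_mono fun ω => ?_) (lintegral_liminf_le
    (u := atTop) (f := fun (k : ℕ) ω => ENNReal.ofReal
      (satWeight 1 b δ (1 / ((k : ℝ) + 1)) (Λ t ω, Γ t ω, N t ω))) fun k => ?_)) ?_
  · refine le_of_eq (Tendsto.liminf_eq ?_).symm
    exact ENNReal.tendsto_ofReal (tendsto_one_sub_exp_div _)
  · have hm := (measurable_weight 1 b δ).comp (hX.measurable t)
    unfold satWeight
    exact ((((hm.const_mul _).neg.exp).const_sub 1).div_const _).ennreal_ofReal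
  · exact liminf_le_of_le (by isBoundedDefault) fun y hy =>
      let ⟨k, hk⟩ := hy.exists
      hk.trans (hbound k)

theorem IsBufferHawkes.integrable_lyapunov (hX : IsBufferHawkes μ ℱ lam0 a b c d Λ Γ N)
    (hlam0 : 0 < lam0) (hb : 0 < b) (hc : 0 < c) (hd : 0 ≤ d) (hstab : a * c < b * (c + d))
    (t : ℝ≥0) :
    Integrable (fun ω => weight 1 b ((b * (c + d) - a * c) / c) (Λ t ω, Γ t ω, N t ω)) μ := by
  have hδ0 : 0 ≤ (b * (c + d) - a * c) / c := div_nonneg (by linarith) hc.le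
  refine ⟨((measurable_weight _ _ _).comp (hX.measurable t)).aestronglyMeasurable, ?_⟩
  rw [hasFiniteIntegral_iff_ofReal (ae_of_all _ fun ω =>
    weight_nonneg zero_le_one hb.le hδ0 (hX.nonneg _ _))]
  exact (hX.lintegral_lyapunov_le hlam0 hb hc hd hstab t).trans_lt ENNReal.ofReal_lt_top

theorem IsBufferHawkes.integrable_prod_lyapunov (hX : IsBufferHawkes μ ℱ lam0 a b c d Λ Γ N)
    (hlam0 : 0 < lam0) (hb : 0 < b) (hc : 0 < c) (hd : 0 ≤ d) (hstab : a * c < b * (c + d))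
    (t : ℝ≥0) :
    Integrable (fun p : ℝ × Ω => weight 1 b ((b * (c + d) - a * c) / c)
      (Λ p.1.toNNReal p.2, Γ p.1.toNNReal p.2, N p.1.toNNReal p.2))
      ((volume.restrict (Set.Ioc 0 (t : ℝ))).prod μ) := by
  have hδ0 : 0 ≤ (b * (c + d) - a * c) / c := div_nonneg (by linarith) hc.le
  have hm : Measurable (fun p : ℝ × Ω => weight 1 b ((b * (c + d) - a * c) / c)
      (Λ p.1.toNNReal p.2, Γ p.1.toNNReal p.2, N p.1.toNNReal p.2)) :=
    (measurable_weight _ _ _).comp hX.measurable_uncurry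
  refine ⟨hm.aestronglyMeasurable, ?_⟩
  rw [hasFiniteIntegral_iff_ofReal (ae_of_all _ fun p =>
    weight_nonneg zero_le_one hb.le hδ0 (hX.nonneg _ _)),
    lintegral_prod _ hm.ennreal_ofReal.aemeasurable]
  refine lt_of_le_of_lt (setLIntegral_mono (g := fun _ => ENNReal.ofReal (lam0 + b * lam0 * t))
    measurable_const fun s hs => ?_) ?_
  · refine (hX.lintegral_lyapunov_le hlam0 hb hc hd hstab s.toNNReal).trans
      (ENNReal.ofReal_le_ofReal ?_)
    rw [Real.coe_toNNReal s hs.1.le]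
    have := mul_le_mul_of_nonneg_left hs.2 (mul_pos hb hlam0).le
    linarith
  · rw [setLIntegral_const]
    exact ENNReal.mul_lt_top ENNReal.ofReal_lt_top (by simp)

/-- Dynkin's formula for a weight with positive coefficients, as the limit `ε → 0` of the formula
for saturated weights: these, and their drifts, are dominated by affine functions of the Lyapunov
weight, which is integrable. -/
theorem IsBufferHawkes.dynkin_weight (hX : IsBufferHawkes μ ℱ lam0 a b c d Λ Γ N)
    (hlam0 : 0 < lam0) (hb : 0 < b) (hc : 0 < c) (hd : 0 ≤ d) (hstab : a * c < b * (c + d))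
    {α β δ : ℝ} (hα : 0 < α) (hβ : 0 < β) (hδ : 0 < δ) (t : ℝ≥0) :
    Dynkin μ (fun t ω => (Λ t ω, Γ t ω, N t ω)) t (weight α β δ)
      (weightDrift lam0 a b c d α β δ) := by
  set δ₀ := (b * (c + d) - a * c) / c with hδ₀
  have hδ0 : 0 < δ₀ := div_pos (by linarith) hc
  set V : ℝ × ℕ × ℕ → ℝ := weight 1 b δ₀ with hV
  have hVx : ∀ x : ℝ × ℕ × ℕ, V x = x.1 + b * x.2.1 + δ₀ * x.2.2 := fun x => by
    simp [hV, weight]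
  -- every weight is bounded by a multiple of the Lyapunov weight
  set R := α + β / b + δ / δ₀ with hR
  have hR0 : 0 < R := by positivity
  have hεp : ∀ k : ℕ, (0 : ℝ) < 1 / ((k : ℝ) + 1) := fun k => by positivity
  have hε1 : ∀ k : ℕ, 1 / ((k : ℝ) + 1) ≤ 1 := fun k =>
    (div_le_one (by positivity)).2 (by linarith [k.cast_nonneg (α := ℝ)])
  have hαR : α ≤ R := by
    have : 0 < β / b := by positivity
    have : 0 < δ / δ₀ := by positivity
    linarith
  have hβR : β ≤ R * b := by
    rw [← div_le_iff₀ hb]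
    have : 0 < δ / δ₀ := by positivity
    linarith
  have hδR : δ ≤ R * δ₀ := by
    rw [← div_le_iff₀ hδ0]
    have : 0 < β / b := by positivity
    linarith
  set E : ℝ → ℝ := fun u => |u| * Real.exp |u| with hE
  have hE0 : ∀ u, 0 ≤ E u := fun u => by positivity
  set D : ℝ := d * E (-β) + c * E (α * a - β + δ) with hDdef
  have hD0 : 0 ≤ D := by have := hE0 (-β); have := hE0 (α * a - β + δ); positivity
  have hV0 := hX.integrable_lyapunov hlam0 hb hc hd hstab
  have hVp := hX.integrable_prod_lyapunov hlam0 hb hc hd hstab t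
  refine Dynkin.of_tendsto (F := fun x => R * V x)
    (G := fun x => α * b * lam0 + (α * b + E β + D / b) * V x) hX.nonneg
    (fun k => hX.dynkin_satWeight hlam0.le hb.le hc.le hd hα hβ hδ.le (hεp k) t)
    (fun x _ => tendsto_one_sub_exp_div _) ?_ ?_ ?_ ((hV0 0).const_mul R) ((hV0 t).const_mul R)
    ((integrable_const _).add (hVp.const_mul _))
  · intro x _
    have h0 : Tendsto (fun k : ℕ => Real.exp (-(1 / ((k : ℝ) + 1) * weight α β δ x)))
        atTop (𝓝 1) := by
      have h1 : Tendsto (fun k : ℕ => 1 / ((k : ℝ) + 1)) atTop (𝓝 0) :=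
        tendsto_one_div_add_atTop_nhds_zero_nat
      have := (Real.continuous_exp.tendsto _).comp (h1.mul_const (weight α β δ x)).neg
      simpa [Function.comp_def] using this
    have key := h0.mul ((((tendsto_const_nhds (x := α * (b * (lam0 - x.1)))).add
      ((tendsto_one_sub_exp_div β).const_mul x.1)).add
      ((tendsto_one_sub_exp_div (-β)).const_mul (d * x.2.1))).add
      ((tendsto_one_sub_exp_div (α * a - β + δ)).const_mul (c * x.2.1)))
    rw [one_mul] at key
    exact key
  · intro k x hx
    have hγ : (0 : ℝ) ≤ x.2.1 := Nat.cast_nonneg _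
    have hn : (0 : ℝ) ≤ x.2.2 := Nat.cast_nonneg _
    rw [abs_of_nonneg (satWeight_nonneg hα.le hβ.le hδ.le (hεp k) hx)]
    refine (one_sub_exp_div_le (hεp k) _).trans ?_
    rw [hVx, weight]
    nlinarith [mul_le_mul_of_nonneg_right hαR hx, mul_le_mul_of_nonneg_right hβR hγ,
      mul_le_mul_of_nonneg_right hδR hn]
  · intro k x hx
    have hγ : (0 : ℝ) ≤ x.2.1 := Nat.cast_nonneg _
    have hn : (0 : ℝ) ≤ x.2.2 := Nat.cast_nonneg _
    have hab := fun u => abs_one_sub_exp_div_le (hεp k) (hε1 k) u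
    have key : ∀ {r : ℝ} (u : ℝ), 0 ≤ r →
        |r * ((1 - Real.exp (-(1 / ((k : ℝ) + 1) * u))) / (1 / ((k : ℝ) + 1)))| ≤ r * E u :=
      fun {r} u hr => by
        rw [abs_mul, abs_of_nonneg hr]
        exact mul_le_mul_of_nonneg_left (hab u) hr
    have k0 : |α * (b * (lam0 - x.1))| ≤ α * (b * (lam0 + x.1)) := by
      rw [abs_mul, abs_mul, abs_of_pos hα, abs_of_pos hb]
      gcongr
      exact (abs_sub _ _).trans (by rw [abs_of_pos hlam0, abs_of_nonneg hx])
    have hsum := (abs_add_le _ _).trans (add_le_add ((abs_add_le _ _).trans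
      (add_le_add ((abs_add_le _ _).trans (add_le_add k0 (key β hx)))
        (key (-β) (mul_nonneg hd hγ)))) (key (α * a - β + δ) (mul_nonneg hc.le hγ)))
    rw [satDrift, abs_mul, abs_of_pos (Real.exp_pos _)]
    refine (mul_le_of_le_one_left (abs_nonneg _) (Real.exp_le_one_iff.2 (neg_nonpos.2
      (mul_nonneg (hεp k).le (weight_nonneg hα.le hβ.le hδ.le hx))))).trans (hsum.trans ?_)
    have h1 : x.1 ≤ V x := by rw [hVx]; nlinarith [mul_nonneg hb.le hγ, mul_nonneg hδ0.le hn]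
    have h2 : D * x.2.1 ≤ D / b * V x := by
      rw [div_mul_eq_mul_div, le_div_iff₀ hb, mul_assoc]
      refine mul_le_mul_of_nonneg_left ?_ hD0
      rw [hVx]; nlinarith [mul_nonneg hδ0.le hn]
    have h3 : (α * b + E β) * x.1 ≤ (α * b + E β) * V x :=
      mul_le_mul_of_nonneg_left h1 (add_nonneg (by positivity) (hE0 β))
    have h4 : d * x.2.1 * E (-β) + c * x.2.1 * E (α * a - β + δ) = D * x.2.1 := by
      rw [hDdef]; ring
    linarith

/-- An arbitrary weight is a difference of two weights with positive coefficients. -/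
theorem IsBufferHawkes.dynkin_weight_of_real (hX : IsBufferHawkes μ ℱ lam0 a b c d Λ Γ N)
    (hlam0 : 0 < lam0) (hb : 0 < b) (hc : 0 < c) (hd : 0 ≤ d) (hstab : a * c < b * (c + d))
    (α β δ : ℝ) (t : ℝ≥0) :
    Dynkin μ (fun t ω => (Λ t ω, Γ t ω, N t ω)) t (weight α β δ)
      (weightDrift lam0 a b c d α β δ) := by
  set R := |α| + |β| + |δ| + 1 with hR
  have hα := neg_abs_le α
  have hβ := neg_abs_le β
  have hδ := neg_abs_le δ
  have hα' := abs_nonneg α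
  have hβ' := abs_nonneg β
  have hδ' := abs_nonneg δ
  have hR0 : 0 < R := by linarith
  have h := (hX.dynkin_weight hlam0 hb hc hd hstab (α := α + R) (β := β + R) (δ := δ + R)
    (by linarith) (by linarith) (by linarith) t).sub
    (hX.dynkin_weight hlam0 hb hc hd hstab hR0 hR0 hR0 t)
  convert h using 1
  · funext x; unfold weight; ring
  · funext x; unfold weightDrift; ring

theorem IsBufferHawkes.integrable_intensity (hX : IsBufferHawkes μ ℱ lam0 a b c d Λ Γ N)
    (hlam0 : 0 < lam0) (hb : 0 < b) (hc : 0 < c) (hd : 0 ≤ d) (hstab : a * c < b * (c + d))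
    (t : ℝ≥0) : Integrable (Λ t) μ := by
  simpa [weight] using (hX.dynkin_weight_of_real hlam0 hb hc hd hstab 1 0 0 t).integrable

theorem IsBufferHawkes.integrable_buffer (hX : IsBufferHawkes μ ℱ lam0 a b c d Λ Γ N)
    (hlam0 : 0 < lam0) (hb : 0 < b) (hc : 0 < c) (hd : 0 ≤ d) (hstab : a * c < b * (c + d))
    (t : ℝ≥0) : Integrable (fun ω => (Γ t ω : ℝ)) μ := by
  simpa [weight] using (hX.dynkin_weight_of_real hlam0 hb hc hd hstab 0 1 0 t).integrable

theorem IsBufferHawkes.integrable_count (hX : IsBufferHawkes μ ℱ lam0 a b c d Λ Γ N)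
    (hlam0 : 0 < lam0) (hb : 0 < b) (hc : 0 < c) (hd : 0 ≤ d) (hstab : a * c < b * (c + d))
    (t : ℝ≥0) : Integrable (fun ω => (N t ω : ℝ)) μ := by
  simpa [weight] using (hX.dynkin_weight_of_real hlam0 hb hc hd hstab 0 0 1 t).integrable

theorem IsBufferHawkes.integral_weightDrift (hX : IsBufferHawkes μ ℱ lam0 a b c d Λ Γ N)
    (hlam0 : 0 < lam0) (hb : 0 < b) (hc : 0 < c) (hd : 0 ≤ d) (hstab : a * c < b * (c + d))
    (α β δ : ℝ) (t : ℝ≥0) :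
    ∫ ω, weightDrift lam0 a b c d α β δ (Λ t ω, Γ t ω, N t ω) ∂μ =
      α * (b * (lam0 - ∫ ω, Λ t ω ∂μ)) + β * ∫ ω, Λ t ω ∂μ
        + (c * (α * a - β + δ) - d * β) * ∫ ω, (Γ t ω : ℝ) ∂μ := by
  have hL := hX.integrable_intensity hlam0 hb hc hd hstab t
  have hG := hX.integrable_buffer hlam0 hb hc hd hstab t
  have h : ∀ ω, weightDrift lam0 a b c d α β δ (Λ t ω, Γ t ω, N t ω) =
      (α * (b * lam0) + (β - α * b) * Λ t ω) + (c * (α * a - β + δ) - d * β) * (Γ t ω : ℝ) :=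
    fun ω => by unfold weightDrift; ring
  simp_rw [h]
  have h1 : Integrable (fun ω => α * (b * lam0) + (β - α * b) * Λ t ω) μ :=
    (integrable_const _).add (hL.const_mul _)
  rw [integral_add h1 (hG.const_mul _), integral_add (integrable_const _) (hL.const_mul _),
    integral_const, integral_const_mul, integral_const_mul]
  simp only [probReal_univ, one_smul]
  ring

/-- Dynkin's formula for `α λ + β γ + δ n`, with the time integral taken outside. -/
theorem IsBufferHawkes.integral_weight (hX : IsBufferHawkes μ ℱ lam0 a b c d Λ Γ N)
    (hlam0 : 0 < lam0) (hb : 0 < b) (hc : 0 < c) (hd : 0 ≤ d) (hstab : a * c < b * (c + d))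
    (α β δ : ℝ) (t : ℝ≥0) :
    IntervalIntegrable (fun s : ℝ => α * (b * (lam0 - ∫ ω, Λ s.toNNReal ω ∂μ))
        + β * ∫ ω, Λ s.toNNReal ω ∂μ
        + (c * (α * a - β + δ) - d * β) * ∫ ω, (Γ s.toNNReal ω : ℝ) ∂μ) volume 0 t ∧
    ∫ ω, weight α β δ (Λ t ω, Γ t ω, N t ω) ∂μ = α * lam0 +
      ∫ s in (0 : ℝ)..t, (α * (b * (lam0 - ∫ ω, Λ s.toNNReal ω ∂μ))
        + β * ∫ ω, Λ s.toNNReal ω ∂μ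
        + (c * (α * a - β + δ) - d * β) * ∫ ω, (Γ s.toNNReal ω : ℝ) ∂μ) := by
  have h := hX.dynkin_weight_of_real hlam0 hb hc hd hstab α β δ t
  have hi := h.integrable_drift.integral_prod_left
  have he := h.integral_eq
  rw [integral_prod _ h.integrable_drift, hX.integral_initial] at he
  simp only [hX.integral_weightDrift hlam0 hb hc hd hstab] at hi he
  refine ⟨(intervalIntegrable_iff_integrableOn_Ioc_of_le t.coe_nonneg).2 hi, ?_⟩
  rw [he, intervalIntegral.integral_of_le t.coe_nonneg]
  simp [weight]

end Moments

/-! ### The linear system for the means -/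

/-- A function that equals a primitive on `[0, ∞)` and is constant on `(-∞, 0]` is continuous. -/
theorem continuous_of_eq_primitive {u h : ℝ → ℝ} {C : ℝ} (hu : ∀ s, u (max s 0) = u s)
    (hi : ∀ t : ℝ, 0 ≤ t → IntervalIntegrable h volume 0 t)
    (h' : ∀ t : ℝ, 0 ≤ t → u t = C + ∫ s in (0 : ℝ)..t, h s) : Continuous u := by
  have hon : ContinuousOn u (Set.Ici 0) := by
    intro t ht
    have ht : (0 : ℝ) ≤ t := ht
    have h1 : ContinuousOn (fun x => C + ∫ s in (0 : ℝ)..x, h s) (Set.uIcc 0 (t + 1)) :=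
      continuousOn_const.add (intervalIntegral.continuousOn_primitive_interval
        ((intervalIntegrable_iff' (by simp)).1 (hi (t + 1) (by linarith))))
    rw [Set.uIcc_of_le (by linarith)] at h1
    have h2 : ContinuousOn u (Set.Icc 0 (t + 1)) := h1.congr fun s hs => h' s hs.1
    refine (h2 t ⟨ht, by linarith⟩).mono_of_mem_nhdsWithin ?_
    filter_upwards [self_mem_nhdsWithin,
      mem_nhdsWithin_of_mem_nhds (Iic_mem_nhds (by linarith : t < t + 1))] with s h1 h2
    exact ⟨h1, h2⟩
  have := hon.comp_continuous (continuous_id.max continuous_const)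
    (fun s => le_max_right s 0)
  exact this.congr hu

theorem hasDerivWithinAt_of_eq_primitive {u h : ℝ → ℝ} {C : ℝ} (hc : Continuous h)
    (h' : ∀ t : ℝ, 0 ≤ t → u t = C + ∫ s in (0 : ℝ)..t, h s) {t : ℝ} (ht : 0 ≤ t) :
    HasDerivWithinAt u (h t) (Set.Ici t) t :=
  ((hc.integral_hasStrictDerivAt 0 t).hasDerivAt.const_add C).hasDerivWithinAt.congr
    (fun s hs => h' s (ht.trans hs)) (h' t ht)

/-- Two solutions on `[0, ∞)` of `p' = b (C - p) + k q`, `q' = p - m q` with the same initial values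
agree. -/
theorem linear_system_unique {b k m : ℝ} {p q p₁ q₁ : ℝ → ℝ} {C : ℝ}
    (hp : Continuous p) (hq : Continuous q) (hp₁ : Continuous p₁) (hq₁ : Continuous q₁)
    (hp' : ∀ t, 0 ≤ t → HasDerivWithinAt p (b * (C - p t) + k * q t) (Set.Ici t) t)
    (hq' : ∀ t, 0 ≤ t → HasDerivWithinAt q (p t - m * q t) (Set.Ici t) t)
    (hp₁' : ∀ t, 0 ≤ t → HasDerivWithinAt p₁ (b * (C - p₁ t) + k * q₁ t) (Set.Ici t) t)
    (hq₁' : ∀ t, 0 ≤ t → HasDerivWithinAt q₁ (p₁ t - m * q₁ t) (Set.Ici t) t)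
    (hp0 : p 0 = p₁ 0) (hq0 : q 0 = q₁ 0) {t : ℝ} (ht : 0 ≤ t) : p t = p₁ t ∧ q t = q₁ t := by
  let A : ℝ × ℝ →L[ℝ] ℝ × ℝ :=
    ((-b) • ContinuousLinearMap.fst ℝ ℝ ℝ + k • ContinuousLinearMap.snd ℝ ℝ ℝ).prod
      (ContinuousLinearMap.fst ℝ ℝ ℝ - m • ContinuousLinearMap.snd ℝ ℝ ℝ)
  have hA : ∀ x, A x = (-b * x.1 + k * x.2, x.1 - m * x.2) := fun x => rfl
  -- the difference of the two solutions solves the homogeneous system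
  have h := ODE_solution_unique_of_mem_Icc_right (a := 0) (b := t) (v := fun _ => A)
    (s := fun _ => Set.univ) (f := fun s => (p s - p₁ s, q s - q₁ s)) (g := fun _ => 0)
    (K := ‖A‖₊) (fun s _ => A.lipschitz.lipschitzOnWith)
    ((hp.sub hp₁).prodMk (hq.sub hq₁)).continuousOn (fun s hs => ?_) (fun _ _ => Set.mem_univ _)
    continuousOn_const (fun s hs => ?_) (fun _ _ => Set.mem_univ _) ?_
  · have := h (Set.right_mem_Icc.2 ht)
    simpa [sub_eq_zero] using this
  · rw [hA]
    have h1 := (hp' s hs.1).sub (hp₁' s hs.1)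
    have h2 := (hq' s hs.1).sub (hq₁' s hs.1)
    exact (h1.prodMk h2).congr_deriv (Prod.ext (by ring) (by ring))
  · simpa using hasDerivWithinAt_const s (Set.Ici s) (0 : ℝ × ℝ)
  · simp [hp0, hq0]

/-! ### The closed forms -/

section ClosedForm

variable {lam0 a b c d : ℝ}

theorem qPlus_sub_qMinus : qPlus a b c d - qMinus a b c d = Q a b c d := by
  unfold qPlus qMinus; ring

theorem qPlus_add_qMinus : qPlus a b c d + qMinus a b c d = b + c + d := by
  unfold qPlus qMinus; ring

theorem qPlus_mul_qMinus (ha : 0 ≤ a) (hc : 0 ≤ c) :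
    qPlus a b c d * qMinus a b c d = b * (c + d) - a * c := by
  have h : Q a b c d ^ 2 = (b - c - d) ^ 2 + 4 * a * c := Real.sq_sqrt (by positivity)
  unfold qPlus qMinus
  linear_combination (-1 / 4) * h

theorem hasDerivAt_exp_neg_mul (q t : ℝ) :
    HasDerivAt (fun t : ℝ => Real.exp (-q * t)) (-q * Real.exp (-q * t)) t := by
  have := ((hasDerivAt_id t).const_mul (-q)).exp
  simpa [mul_comm] using this

theorem mul_integral_exp_neg (q t : ℝ) :
    q * ∫ s in (0 : ℝ)..t, Real.exp (-q * s) = 1 - Real.exp (-q * t) := by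
  rw [← intervalIntegral.integral_const_mul]
  rw [intervalIntegral.integral_eq_sub_of_hasDerivAt
    (f := fun t => -Real.exp (-q * t)) (fun s _ => ?_) (by
      apply Continuous.intervalIntegrable; fun_prop)]
  · simp; ring
  · exact (hasDerivAt_exp_neg_mul q s).neg.congr_deriv (by ring)

theorem continuous_exp_sub_exp (q q' : ℝ) :
    Continuous (fun s : ℝ => Real.exp (-q * s) - Real.exp (-q' * s)) := by fun_prop

theorem mul_mul_integral_exp_sub_exp (q q' t : ℝ) :
    q * q' * ∫ s in (0 : ℝ)..t, (Real.exp (-q * s) - Real.exp (-q' * s)) =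
      q' * (1 - Real.exp (-q * t)) - q * (1 - Real.exp (-q' * t)) := by
  rw [intervalIntegral.integral_sub
    (by apply Continuous.intervalIntegrable; fun_prop)
    (by apply Continuous.intervalIntegrable; fun_prop), ← mul_integral_exp_neg q,
    ← mul_integral_exp_neg q']
  ring

/-- The closed form of the mean intensity, meaningful for `Q a b c d ≠ 0` (it is `0` otherwise). -/
noncomputable def meanIntensity (lam0 a b c d t : ℝ) : ℝ :=
  lam0 / (qPlus a b c d - qMinus a b c d) *
    (qPlus a b c d - qMinus a b c d + a * c * ∫ s in (0 : ℝ)..t,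
      (Real.exp (-qMinus a b c d * s) - Real.exp (-qPlus a b c d * s)))

/-- The closed form of the mean buffer size, meaningful for `Q a b c d ≠ 0` (it is `0`
otherwise). -/
noncomputable def meanBuffer (lam0 a b c d t : ℝ) : ℝ :=
  lam0 / (qPlus a b c d - qMinus a b c d) *
    (Real.exp (-qMinus a b c d * t) - Real.exp (-qPlus a b c d * t) + b * ∫ s in (0 : ℝ)..t,
      (Real.exp (-qMinus a b c d * s) - Real.exp (-qPlus a b c d * s)))

theorem hasDerivAt_meanIntensity (hQ : Q a b c d ≠ 0) (t : ℝ) :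
    HasDerivAt (meanIntensity lam0 a b c d)
      (b * (lam0 - meanIntensity lam0 a b c d t) + a * c * meanBuffer lam0 a b c d t) t := by
  have h := (((continuous_exp_sub_exp (qMinus a b c d)
    (qPlus a b c d)).integral_hasStrictDerivAt 0 t).hasDerivAt.const_mul (a * c)).const_add
    (qPlus a b c d - qMinus a b c d) |>.const_mul (lam0 / (qPlus a b c d - qMinus a b c d))
  refine h.congr_deriv ?_
  unfold meanIntensity meanBuffer
  rw [qPlus_sub_qMinus]
  field_simp
  ring

theorem hasDerivAt_meanBuffer (ha : 0 ≤ a) (hc : 0 ≤ c) (t : ℝ) :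
    HasDerivAt (meanBuffer lam0 a b c d)
      (meanIntensity lam0 a b c d t - (c + d) * meanBuffer lam0 a b c d t) t := by
  have h := (((hasDerivAt_exp_neg_mul (qMinus a b c d) t).sub
    (hasDerivAt_exp_neg_mul (qPlus a b c d) t)).add
    (((continuous_exp_sub_exp (qMinus a b c d)
      (qPlus a b c d)).integral_hasStrictDerivAt 0 t).hasDerivAt.const_mul b)).const_mul
    (lam0 / (qPlus a b c d - qMinus a b c d))
  refine h.congr_deriv ?_
  have hI := mul_mul_integral_exp_sub_exp (qMinus a b c d) (qPlus a b c d) t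
  have hm := qPlus_mul_qMinus (b := b) (d := d) ha hc
  have hs := qPlus_add_qMinus (a := a) (b := b) (c := c) (d := d)
  unfold meanIntensity meanBuffer
  generalize (∫ s in (0 : ℝ)..t,
    (Real.exp (-qMinus a b c d * s) - Real.exp (-qPlus a b c d * s))) = I at *
  generalize Real.exp (-qMinus a b c d * t) = x at *
  generalize Real.exp (-qPlus a b c d * t) = y at *
  generalize qMinus a b c d = q at *
  generalize qPlus a b c d = r at *
  -- `hI` gives the integral times `q₊ q₋ = b (c + d) - a c`, so that no division by `q₋` is needed
  linear_combination (lam0 / (r - q)) * (hI - I * hm + (y - x) * hs)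

theorem eq_zero_of_Q_eq_zero (ha : 0 ≤ a) (hc : 0 < c) (hQ : Q a b c d = 0) :
    a = 0 ∧ b = c + d := by
  have h : (b - c - d) ^ 2 + 4 * a * c = 0 :=
    (Real.sqrt_eq_zero (by positivity)).1 hQ
  have h1 : 0 ≤ a * c := by positivity
  have h2 : a * c = 0 := by nlinarith [sq_nonneg (b - c - d)]
  have h3 : b - c - d = 0 := by
    apply pow_eq_zero_iff (two_ne_zero) |>.1
    linarith
  exact ⟨(mul_eq_zero.1 h2).resolve_right hc.ne', by linarith⟩

theorem hasDerivAt_meanBuffer_degenerate {m : ℝ} (hm : m ≠ 0) (t : ℝ) :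
    HasDerivAt (fun t : ℝ => lam0 / m * (1 - Real.exp (-m * t)))
      (lam0 - m * (lam0 / m * (1 - Real.exp (-m * t)))) t := by
  refine (((hasDerivAt_exp_neg_mul m t).const_sub 1).const_mul (lam0 / m)).congr_deriv ?_
  field_simp
  ring

end ClosedForm

end BufferHawkes

theorem proposition2p1 {Ω : Type*} {mΩ : MeasurableSpace Ω} (μ : Measure Ω)
    [IsProbabilityMeasure μ] (ℱ : Filtration ℝ≥0 mΩ)
    (lam0 a b c d : ℝ) (hlam0 : 0 < lam0) (ha : 0 ≤ a) (hb : 0 < b) (hc : 0 < c) (hd : 0 ≤ d)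
    (hstab : a * c < b * (c + d))
    (Λ : ℝ≥0 → Ω → ℝ) (Γ N : ℝ≥0 → Ω → ℕ)
    (hX : BufferHawkes.IsBufferHawkes μ ℱ lam0 a b c d Λ Γ N) :
    ∀ t : ℝ≥0,
      -- the three first moments are finite
      Integrable (Λ t) μ ∧ Integrable (fun ω => (Γ t ω : ℝ)) μ ∧
      Integrable (fun ω => (N t ω : ℝ)) μ ∧
      -- the closed forms for the means of `Λ` and `Γ`
      (BufferHawkes.Q a b c d ≠ 0 →
        ∫ ω, Λ t ω ∂μ = lam0 / (BufferHawkes.qPlus a b c d - BufferHawkes.qMinus a b c d) *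
          (BufferHawkes.qPlus a b c d - BufferHawkes.qMinus a b c d + a * c * ∫ s in (0 : ℝ)..(t : ℝ),
            (Real.exp (-BufferHawkes.qMinus a b c d * s) - Real.exp (-BufferHawkes.qPlus a b c d * s))) ∧
        ∫ ω, (Γ t ω : ℝ) ∂μ = lam0 / (BufferHawkes.qPlus a b c d - BufferHawkes.qMinus a b c d) *
          (Real.exp (-BufferHawkes.qMinus a b c d * t) - Real.exp (-BufferHawkes.qPlus a b c d * t)
            + b * ∫ s in (0 : ℝ)..(t : ℝ),
            (Real.exp (-BufferHawkes.qMinus a b c d * s) - Real.exp (-BufferHawkes.qPlus a b c d * s)))) ∧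
      -- the degenerate case `a = 0`, `b = c + d`, where the quotients are replaced by their limits
      (BufferHawkes.Q a b c d = 0 →
        ∫ ω, Λ t ω ∂μ = lam0 ∧
        ∫ ω, (Γ t ω : ℝ) ∂μ = lam0 / (c + d) * (1 - Real.exp (-(c + d) * t))) ∧
      -- the mean of `N`
      ∫ ω, (N t ω : ℝ) ∂μ = c * ∫ s in (0 : ℝ)..(t : ℝ), (∫ ω, (Γ s.toNNReal ω : ℝ) ∂μ) := by
  set L : ℝ → ℝ := fun s => ∫ ω, Λ s.toNNReal ω ∂μ with hL
  set G : ℝ → ℝ := fun s => ∫ ω, (Γ s.toNNReal ω : ℝ) ∂μ with hG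
  have hmean := hX.integral_weight hlam0 hb hc hd hstab
  have hmax : ∀ s : ℝ, (max s 0).toNNReal = s.toNNReal := fun s => by
    simp [Real.toNNReal]
  have hLi : ∀ t : ℝ, 0 ≤ t →
      IntervalIntegrable (fun s => b * (lam0 - L s) + a * c * G s) volume 0 t := fun t ht => by
    have := (hmean 1 0 0 t.toNNReal).1
    rw [Real.coe_toNNReal t ht] at this
    refine this.congr (fun s _ => ?_)
    ring
  have hLe : ∀ t : ℝ, 0 ≤ t →
      L t = lam0 + ∫ s in (0 : ℝ)..t, (b * (lam0 - L s) + a * c * G s) := fun t ht => by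
    have := (hmean 1 0 0 t.toNNReal).2
    rw [Real.coe_toNNReal t ht] at this
    simp only [BufferHawkes.weight, one_mul, zero_mul, add_zero] at this
    rw [hL]
    dsimp only
    rw [this]
    congr 1
    refine intervalIntegral.integral_congr fun s _ => ?_
    ring
  have hGi : ∀ t : ℝ, 0 ≤ t →
      IntervalIntegrable (fun s => L s - (c + d) * G s) volume 0 t := fun t ht => by
    have := (hmean 0 1 0 t.toNNReal).1
    rw [Real.coe_toNNReal t ht] at this
    refine this.congr (fun s _ => ?_)
    ring
  have hGe : ∀ t : ℝ, 0 ≤ t →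
      G t = 0 + ∫ s in (0 : ℝ)..t, (L s - (c + d) * G s) := fun t ht => by
    have := (hmean 0 1 0 t.toNNReal).2
    rw [Real.coe_toNNReal t ht] at this
    simp only [BufferHawkes.weight, one_mul, zero_mul, add_zero, zero_add] at this
    rw [hG]
    dsimp only
    rw [this, zero_add]
    refine intervalIntegral.integral_congr fun s _ => ?_
    ring
  have hLc : Continuous L :=
    BufferHawkes.continuous_of_eq_primitive (fun s => by rw [hL]; simp only [hmax]) hLi hLe
  have hGc : Continuous G :=
    BufferHawkes.continuous_of_eq_primitive (fun s => by rw [hG]; simp only [hmax]) hGi hGe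
  have hLd : ∀ t, 0 ≤ t → HasDerivWithinAt L (b * (lam0 - L t) + a * c * G t) (Set.Ici t) t :=
    fun t ht => BufferHawkes.hasDerivWithinAt_of_eq_primitive (by fun_prop) hLe ht
  have hGd : ∀ t, 0 ≤ t → HasDerivWithinAt G (L t - (c + d) * G t) (Set.Ici t) t :=
    fun t ht => BufferHawkes.hasDerivWithinAt_of_eq_primitive (by fun_prop) hGe ht
  have hL0 : L 0 = lam0 := by simpa using hLe 0 le_rfl
  have hG0 : G 0 = 0 := by simpa using hGe 0 le_rfl
  intro t
  have hLt : ∫ ω, Λ t ω ∂μ = L t := by simp [hL]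
  have hGt : ∫ ω, (Γ t ω : ℝ) ∂μ = G t := by simp [hG]
  rw [hLt, hGt]
  refine ⟨hX.integrable_intensity hlam0 hb hc hd hstab t,
    hX.integrable_buffer hlam0 hb hc hd hstab t,
    hX.integrable_count hlam0 hb hc hd hstab t, fun hQ => ?_, fun hQ => ?_, ?_⟩
  · have h1 := fun t => BufferHawkes.hasDerivAt_meanIntensity (lam0 := lam0) hQ t
    have h2 := fun t =>
      BufferHawkes.hasDerivAt_meanBuffer (lam0 := lam0) (b := b) (d := d) ha hc.le t
    refine BufferHawkes.linear_system_unique hLc hGc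
      (continuous_iff_continuousAt.2 fun t => (h1 t).continuousAt)
      (continuous_iff_continuousAt.2 fun t => (h2 t).continuousAt) hLd hGd
      (fun t _ => (h1 t).hasDerivWithinAt) (fun t _ => (h2 t).hasDerivWithinAt) ?_ ?_ t.coe_nonneg
    · rw [hL0, BufferHawkes.meanIntensity, BufferHawkes.qPlus_sub_qMinus]
      simp [hQ]
    · rw [hG0, BufferHawkes.meanBuffer]
      simp
  · obtain ⟨rfl, rfl⟩ := BufferHawkes.eq_zero_of_Q_eq_zero ha hc hQ
    have h2 := fun t => BufferHawkes.hasDerivAt_meanBuffer_degenerate (lam0 := lam0) hb.ne' t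
    refine BufferHawkes.linear_system_unique hLc hGc continuous_const
      (continuous_iff_continuousAt.2 fun t => (h2 t).continuousAt) hLd hGd
      (fun t _ => ?_) (fun t _ => (h2 t).hasDerivWithinAt) hL0 (by simp [hG0]) t.coe_nonneg
    simpa using hasDerivWithinAt_const t (Set.Ici t) lam0
  · have := (hmean 0 0 1 t).2
    simpa [BufferHawkes.weight] using this
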